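/- Let $M\subset\mathbb{C}^3$ be a real-analytic $4$-dimensional (hence codimension $2$) generic CR-submanifold, i.e. a real-analytic submanifold with $T_qM+iT_qM=\mathbb{C}^3$ for all $q\in M$, so that the complex tangent spaces $T_q^{\mathbb{C}}M=T_qM\cap iT_qM$ form a bundle $T^{\mathbb{C}}M$ of complex lines. Let $p\in M$, and suppose that $M$ is totally non-degenerate at $p$, i.e. $$T_p^{\mathbb{C}}M+[T^{\mathbb{C}}M,T^{\mathbb{C}}M]_p+[T^{\mathbb{C}}M,[T^{\mathbb{C}}M,T^{\mathbb{C}}M]]_p=T_pM,$$ where the second and third terms are the real spans of the values at $p$ of the single and double Lie brackets of local smooth sections of $T^{\mathbb{C}}M$ near $p$. Let $\mathfrak{aut}\,M_p$ be the real Lie algebra of germs at $p$ of holomorphic vector fields $2\,\mathrm{Re}\,\bigl(f_1\frac{\partial}{\partial z_1}+f_2\frac{\partial}{\partial z_2}+f_3\frac{\partial}{\partial z_3}\bigr)$ ($f_j$ holomorphic near $p$) that are tangent to $M$ at each point of $M$ near $p$. Suppose that the local homogeneity of $M$ at $p$ is provided by a $4$-dimensional real Lie subalgebra $\mathfrak{g}(M)\subset\mathfrak{aut}\,M_p$,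 i.e. the values at $p$ of the fields from $\mathfrak{g}(M)$ form all of $T_pM$; let $X_1,X_2,X_3,X_4$ be a basis of $\mathfrak{g}(M)$ over $\mathbb{R}$. If $X_1,X_2,X_3$ span (over $\mathbb{R}$) a $3$-dimensional Lie subalgebra $\mathfrak{a}$ of $\mathfrak{g}(M)$, then their values at $p$, i.e. the vectors $(f_1(p),f_2(p),f_3(p))\in\mathbb{C}^3$ attached to the three fields, are linearly independent over $\mathbb{C}$. -/

import Mathlib

open Filter Topology
open scoped ContDiff

namespace CRGeom

noncomputable section

/-- The ambient space `ℂ³`. -/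
abbrev C3 : Type := Fin 3 → ℂ

/-- `f` is `C^∞`, in the real sense, on some neighbourhood of `p`. -/
def SmoothNear {F : Type*} [NormedAddCommGroup F] [NormedSpace ℝ F] (f : C3 → F) (p : C3) : Prop :=
  ∀ᶠ x in 𝓝 p, ContDiffAt ℝ ∞ f x

/-! ### Submanifolds of `ℂ³` and their tangent spaces -/

/-- The (real) tangent space `T_q M` of a subset `M` of `ℂ³` at `q`: the vectors killed by the
differentials at `q` of all smooth real functions, defined near `q`, which vanish on `M` near `q`.
For `q` on an embedded submanifold `M` this is the usual tangent space. -/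
def tangentSpace (M : Set C3) (q : C3) : Submodule ℝ C3 where
  carrier := {v | ∀ f : C3 → ℝ, SmoothNear f q → (∀ᶠ x in 𝓝 q, x ∈ M → f x = 0) →
    fderiv ℝ f q v = 0}
  add_mem' := fun hv hw f hf h0 => by rw [map_add, hv f hf h0, hw f hf h0, add_zero]
  zero_mem' := fun f _ _ => map_zero _
  smul_mem' := fun c v hv f hf h0 => by rw [map_smul, hv f hf h0, smul_zero]

/-- The complex tangent space `T_q^ℂ M = T_q M ∩ i T_q M`, as a set of vectors `v` such that
both `v` and `i v` are tangent to `M`. -/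
def complexTangentSpace (M : Set C3) (q : C3) : Submodule ℝ C3 where
  carrier := {v | v ∈ tangentSpace M q ∧ Complex.I • v ∈ tangentSpace M q}
  add_mem' := fun hv hw => ⟨add_mem hv.1 hw.1, by rw [smul_add]; exact add_mem hv.2 hw.2⟩
  zero_mem' := ⟨zero_mem _, by rw [smul_zero]; exact zero_mem _⟩
  smul_mem' := fun c v hv => ⟨Submodule.smul_mem _ c hv.1, by
    rw [smul_comm]; exact Submodule.smul_mem _ c hv.2⟩

/-- `M` is a real-analytic `4`-dimensional generic CR-submanifold of `ℂ³`: near each of its points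
it is the zero set of a real-analytic submersion onto `ℝ²`, and each of its tangent spaces spans
`ℂ³` over `ℂ` (so that all complex tangent spaces are complex lines). -/
structure IsGenericCRSubmanifold (M : Set C3) : Prop where
  isSubmanifold : ∀ q ∈ M, ∃ (U : Set C3) (ρ : C3 → (Fin 2 → ℝ)), IsOpen U ∧ q ∈ U ∧
    AnalyticOnNhd ℝ ρ U ∧ (∀ x ∈ U, x ∈ M ↔ ρ x = 0) ∧
    ∀ x ∈ U, x ∈ M → Function.Surjective (fderiv ℝ ρ x)
  isGeneric : ∀ q ∈ M, Submodule.span ℂ (tangentSpace M q : Set C3) = ⊤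

/-! ### Total non-degeneracy -/

/-- The local smooth sections near `p` of the bundle `T^ℂ M` of complex tangent spaces,
represented by smooth vector fields on the ambient space. (Lie brackets of vector fields tangent to
`M` can be computed, at the points of `M`, from any such representatives.) -/
def complexTangentSections (M : Set C3) (p : C3) : Set (C3 → C3) :=
  {V | SmoothNear V p ∧ ∀ᶠ x in 𝓝 p, x ∈ M → V x ∈ complexTangentSpace M x}

/-- The space `[T^ℂ M, T^ℂ M]_p`. -/
def bracketSpace (M : Set C3) (p : C3) : Submodule ℝ C3 :=
  Submodule.span ℝ {v | ∃ V ∈ complexTangentSections M p, ∃ W ∈ complexTangentSections M p,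
    v = VectorField.lieBracket ℝ V W p}

/-- The space `[T^ℂ M, [T^ℂ M, T^ℂ M]]_p`. -/
def doubleBracketSpace (M : Set C3) (p : C3) : Submodule ℝ C3 :=
  Submodule.span ℝ {v | ∃ U ∈ complexTangentSections M p, ∃ V ∈ complexTangentSections M p,
    ∃ W ∈ complexTangentSections M p,
    v = VectorField.lieBracket ℝ U (VectorField.lieBracket ℝ V W) p}

/-- `M` is totally non-degenerate at `p`. -/
def IsTotallyNondegenerateAt (M : Set C3) (p : C3) : Prop :=
  complexTangentSpace M p ⊔ bracketSpace M p ⊔ doubleBracketSpace M p = tangentSpace M p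

/-! ### Germs of holomorphic vector fields -/

/-- The Lie bracket of germs of vector fields. -/
def germBracket {p : C3} (φ ψ : Germ (𝓝 p) C3) : Germ (𝓝 p) C3 :=
  Quotient.map₂ (VectorField.lieBracket ℝ)
    (fun _ _ h₁ _ _ h₂ => Filter.EventuallyEq.lieBracket_vectorField h₁ h₂) φ ψ

theorem germBracket_coe {p : C3} (f g : C3 → C3) :
    germBracket (f : Germ (𝓝 p) C3) (g : Germ (𝓝 p) C3) =
      ((VectorField.lieBracket ℝ f g : C3 → C3) : Germ (𝓝 p) C3) := rfl

/-- The germs at `p` of holomorphic vector fields. The real vector field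
`2 Re (f₁ ∂/∂z₁ + f₂ ∂/∂z₂ + f₃ ∂/∂z₃)` takes at `z` the value `(f₁ z, f₂ z, f₃ z) ∈ ℂ³ = ℝ⁶`; it is
identified with the germ of the holomorphic map `f`. -/
def HolVF (p : C3) : Submodule ℝ (Germ (𝓝 p) C3) where
  carrier := {φ | ∃ f : C3 → C3, AnalyticAt ℂ f p ∧ (f : Germ (𝓝 p) C3) = φ}
  add_mem' := by
    rintro _ _ ⟨f, hf, rfl⟩ ⟨g, hg, rfl⟩
    exact ⟨f + g, hf.add hg, rfl⟩
  zero_mem' := ⟨0, analyticAt_const, rfl⟩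
  smul_mem' := by
    rintro c _ ⟨f, hf, rfl⟩
    exact ⟨c • f, (hf.const_smul (c := (c : ℂ))).congr (Eventually.of_forall fun x => by simp), rfl⟩

theorem analyticAt_clm_apply {p : C3} {A : C3 → C3 →L[ℂ] C3} {f : C3 → C3}
    (hA : AnalyticAt ℂ A p) (hf : AnalyticAt ℂ f p) : AnalyticAt ℂ (fun x => A x (f x)) p :=
  ContDiffAt.analyticAt (hA.contDiffAt.clm_apply hf.contDiffAt)

theorem analyticAt_lieBracket {p : C3} {f g : C3 → C3} (hf : AnalyticAt ℂ f p)
    (hg : AnalyticAt ℂ g p) : AnalyticAt ℂ (VectorField.lieBracket ℝ f g) p := by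
  have h : AnalyticAt ℂ (fun x => fderiv ℂ g x (f x) - fderiv ℂ f x (g x)) p :=
    (analyticAt_clm_apply hg.fderiv hf).sub (analyticAt_clm_apply hf.fderiv hg)
  refine h.congr ?_
  filter_upwards [hf.eventually_analyticAt, hg.eventually_analyticAt] with x hfx hgx
  rw [VectorField.lieBracket, hfx.differentiableAt.fderiv_restrictScalars ℝ,
    hgx.differentiableAt.fderiv_restrictScalars ℝ]
  rfl

theorem contDiffAt_of_analyticAt {p : C3} {f : C3 → C3} (hf : AnalyticAt ℂ f p) {n : WithTop ℕ∞} :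
    ContDiffAt ℝ n f p := (hf.restrictScalars (𝕜 := ℝ)).contDiffAt

theorem differentiableAt_of_analyticAt {p : C3} {f : C3 → C3} (hf : AnalyticAt ℂ f p) :
    DifferentiableAt ℝ f p := hf.differentiableAt.restrictScalars ℝ

theorem germBracket_mem {p : C3} {φ ψ : Germ (𝓝 p) C3} (hφ : φ ∈ HolVF p) (hψ : ψ ∈ HolVF p) :
    germBracket φ ψ ∈ HolVF p := by
  obtain ⟨f, hf, rfl⟩ := hφ
  obtain ⟨g, hg, rfl⟩ := hψ
  exact ⟨_, analyticAt_lieBracket hf hg, rfl⟩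

instance (p : C3) : Bracket (HolVF p) (HolVF p) :=
  ⟨fun X Y => ⟨germBracket X.1 Y.1, germBracket_mem X.2 Y.2⟩⟩

theorem HolVF.coe_lie {p : C3} (X Y : HolVF p) :
    ((⁅X, Y⁆ : HolVF p) : Germ (𝓝 p) C3) = germBracket X.1 Y.1 := rfl

instance (p : C3) : LieRing (HolVF p) where
  add_lie := by
    rintro ⟨_, f, hf, rfl⟩ ⟨_, g, hg, rfl⟩ ⟨_, h, hh, rfl⟩
    refine Subtype.ext (Germ.coe_eq.2 ?_)
    filter_upwards [hf.eventually_analyticAt, hg.eventually_analyticAt] with x hfx hgx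
    exact VectorField.lieBracket_add_left (differentiableAt_of_analyticAt hfx)
      (differentiableAt_of_analyticAt hgx)
  lie_add := by
    rintro ⟨_, f, hf, rfl⟩ ⟨_, g, hg, rfl⟩ ⟨_, h, hh, rfl⟩
    refine Subtype.ext (Germ.coe_eq.2 ?_)
    filter_upwards [hg.eventually_analyticAt, hh.eventually_analyticAt] with x hgx hhx
    exact VectorField.lieBracket_add_right (differentiableAt_of_analyticAt hgx)
      (differentiableAt_of_analyticAt hhx)
  lie_self := by
    rintro ⟨_, f, hf, rfl⟩
    refine Subtype.ext (Germ.coe_eq.2 ?_)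
    rw [VectorField.lieBracket_self]
    exact EventuallyEq.rfl
  leibniz_lie := by
    rintro ⟨_, f, hf, rfl⟩ ⟨_, g, hg, rfl⟩ ⟨_, h, hh, rfl⟩
    refine Subtype.ext (Germ.coe_eq.2 ?_)
    filter_upwards [hf.eventually_analyticAt, hg.eventually_analyticAt,
      hh.eventually_analyticAt] with x hfx hgx hhx
    exact VectorField.leibniz_identity_lieBracket (n := ω) le_top (contDiffAt_of_analyticAt hfx)
      (contDiffAt_of_analyticAt hgx) (contDiffAt_of_analyticAt hhx)

/-- The germs at `p` of holomorphic vector fields form a real Lie algebra. -/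
instance (p : C3) : LieAlgebra ℝ (HolVF p) where
  lie_smul := by
    rintro c ⟨_, f, hf, rfl⟩ ⟨_, g, hg, rfl⟩
    refine Subtype.ext (Germ.coe_eq.2 ?_)
    filter_upwards [hg.eventually_analyticAt] with x hgx
    exact VectorField.lieBracket_const_smul_right (differentiableAt_of_analyticAt hgx)

/-- The evaluation mapping `ε_p : X ↦ X|_p`. -/
def eval (p : C3) : HolVF p →ₗ[ℝ] C3 := Germ.valueₗ ∘ₗ (HolVF p).subtype

/-! ### Infinitesimal automorphisms -/

/-- The germ `φ` of a vector field at `p` is tangent to `M` at each point of `M` near `p`. -/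
def IsTangentGerm (M : Set C3) {p : C3} (φ : Germ (𝓝 p) C3) : Prop :=
  ∃ f : C3 → C3, (f : Germ (𝓝 p) C3) = φ ∧ ∀ᶠ x in 𝓝 p, x ∈ M → f x ∈ tangentSpace M x

theorem isTangentGerm_coe {M : Set C3} {p : C3} {f : C3 → C3} :
    IsTangentGerm M (f : Germ (𝓝 p) C3) ↔ ∀ᶠ x in 𝓝 p, x ∈ M → f x ∈ tangentSpace M x := by
  refine ⟨?_, fun h => ⟨f, rfl, h⟩⟩
  rintro ⟨g, hg, h⟩
  filter_upwards [h, Germ.coe_eq.1 hg] with x hx hgx hxM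
  rw [← hgx]
  exact hx hxM

theorem lieBracket_mem_tangentSpace {M : Set C3} {p : C3} {f g : C3 → C3} (hpM : p ∈ M)
    (hf : SmoothNear f p) (hg : SmoothNear g p)
    (hfM : ∀ᶠ x in 𝓝 p, x ∈ M → f x ∈ tangentSpace M x)
    (hgM : ∀ᶠ x in 𝓝 p, x ∈ M → g x ∈ tangentSpace M x) :
    VectorField.lieBracket ℝ f g p ∈ tangentSpace M p := by
  intro u hu hu0
  have key : ∀ k : C3 → C3, SmoothNear k p → (∀ᶠ x in 𝓝 p, x ∈ M → k x ∈ tangentSpace M x) →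
      SmoothNear (fun x => fderiv ℝ u x (k x)) p ∧
        ∀ᶠ x in 𝓝 p, x ∈ M → fderiv ℝ u x (k x) = 0 := by
    intro k hk hkM
    constructor
    · filter_upwards [hu, hk] with x hux hkx
      exact (hux.fderiv_right (m := ∞) (by simp)).clm_apply hkx
    · filter_upwards [hkM, hu.eventually_nhds, hu0.eventually_nhds] with x h1 h2 h3 hxM
      exact h1 hxM u h2 h3
  have h1 := key f hf hfM
  have h2 := key g hg hgM
  have e1 := hfM.self_of_nhds hpM _ h2.1 h2.2
  have e2 := hgM.self_of_nhds hpM _ h1.1 h1.2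
  have hu' := hu.self_of_nhds
  have hf' := hf.self_of_nhds
  have hg' := hg.self_of_nhds
  rw [VectorField.fderiv_apply_lieBracket (n := ∞) hu'
    (by rw [minSmoothness_of_isRCLikeNormedField]; exact WithTop.coe_le_coe.2 le_top)
    (hg'.differentiableAt (by simp)) (hf'.differentiableAt (by simp)), e1, e2, sub_zero]

/-- The infinitesimal automorphism algebra `𝔞𝔲𝔱 M_p` of `M` at `p`: the real Lie algebra of the
germs at `p` of holomorphic vector fields which are tangent to `M` at each point. -/
def infAut (M : Set C3) (p : C3) : LieSubalgebra ℝ (HolVF p) where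
  carrier := {X | IsTangentGerm M (X : Germ (𝓝 p) C3)}
  add_mem' := by
    rintro ⟨_, f, hf, rfl⟩ ⟨_, g, hg, rfl⟩ hfM hgM
    refine ⟨f + g, rfl, ?_⟩
    filter_upwards [isTangentGerm_coe.1 hfM, isTangentGerm_coe.1 hgM] with x h1 h2 hxM
    exact add_mem (h1 hxM) (h2 hxM)
  zero_mem' := ⟨0, rfl, Eventually.of_forall fun x _ => zero_mem _⟩
  smul_mem' := by
    rintro c ⟨_, f, hf, rfl⟩ hfM
    refine ⟨c • f, rfl, ?_⟩
    filter_upwards [isTangentGerm_coe.1 hfM] with x h1 hxM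
    exact Submodule.smul_mem _ c (h1 hxM)
  lie_mem' := by
    rintro ⟨_, f, hf, rfl⟩ ⟨_, g, hg, rfl⟩ hfM hgM
    refine ⟨VectorField.lieBracket ℝ f g, rfl, ?_⟩
    filter_upwards [hf.eventually_analyticAt.eventually_nhds,
      hg.eventually_analyticAt.eventually_nhds, (isTangentGerm_coe.1 hfM).eventually_nhds,
      (isTangentGerm_coe.1 hgM).eventually_nhds] with x h1 h2 h3 h4 hxM
    exact lieBracket_mem_tangentSpace hxM (h1.mono fun y hy => contDiffAt_of_analyticAt hy)
      (h2.mono fun y hy => contDiffAt_of_analyticAt hy) h3 h4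

/-- `g` is a `4`-dimensional real Lie algebra of infinitesimal automorphisms of `M` at `p` which
provides the local homogeneity of `M` at `p`: the values at `p` of its elements form all of
`T_p M`. -/
structure ProvidesHomogeneity (M : Set C3) (p : C3) (g : LieSubalgebra ℝ (HolVF p)) : Prop where
  le_infAut : g ≤ infAut M p
  finrank_eq : Module.finrank ℝ g = 4
  map_eval : g.toSubmodule.map (eval p) = tangentSpace M p

end

end CRGeom

/-! Write `Y 0, Y 1, Y 2` for the fields spanning the subalgebra, `Z` for the fourth field, and
suppose the `Y j` are dependent over `ℂ` at `p`. By genericity they can be reordered so that `Y 0, Y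
1, Z` is a complex basis at `p`. Let `D` be the complex determinant of the `Y j`, and `Δ` that of `Y
0, Y 1, Z`.

The `Y j` are holomorphic and closed under brackets with constant coefficients, so `Y i D = h i * D`
with smooth `h i` (`fderiv_det3_along`). As `D p = 0`, `D` vanishes along the 3-dimensional orbit of
the subalgebra through `p`. If `V = ∑ a j • X j` is a section of `T^ℂ M` in the frame `X = (Y 0, Y
1, Y 2, Z)` and `i V = ∑ b j • X j`, Cramer's rule gives `(b 3 - i a 3) Δ = -(b 2 - i a 2) D`; where
`D = 0` this forces `a 3 = 0`. So `T^ℂ M` is tangent to the orbit along it, and so are all its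
iterated brackets. At `p` they fill at most 3 dimensions, contradicting total non-degeneracy, as
`T_p M` has dimension 4.

The orbit is never constructed. "Zero along the orbit" becomes "all `Y`-derivatives up to order `k`
vanish at `p`" (`FlatAt`), "tangent to the orbit" becomes `TangentMod`, and a bracket costs one
order (`TangentMod.lieBracket`). -/

namespace CRGeom

/-! ### Calculus of functions smooth near a point. -/

section Smooth

variable {F G H : Type*} [NormedAddCommGroup F] [NormedSpace ℝ F] [NormedAddCommGroup G]
  [NormedSpace ℝ G] [NormedAddCommGroup H] [NormedSpace ℝ H] {p : C3}

theorem SmoothNear.congr {f g : C3 → F} (hf : SmoothNear f p) (h : f =ᶠ[𝓝 p] g) :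
    SmoothNear g p := by
  filter_upwards [hf, h.eventuallyEq_nhds] with x hx hgx
  exact hx.congr_of_eventuallyEq hgx.symm

theorem SmoothNear.eventually {f : C3 → F} (hf : SmoothNear f p) :
    ∀ᶠ x in 𝓝 p, SmoothNear f x :=
  Filter.Eventually.eventually_nhds hf

theorem SmoothNear.eventually_differentiableAt {f : C3 → F} (hf : SmoothNear f p) :
    ∀ᶠ x in 𝓝 p, DifferentiableAt ℝ f x :=
  hf.mono fun _ hx => hx.differentiableAt (by simp)

theorem SmoothNear.differentiableAt {f : C3 → F} (hf : SmoothNear f p) : DifferentiableAt ℝ f p :=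
  hf.eventually_differentiableAt.self_of_nhds

theorem smoothNear_const (c : F) : SmoothNear (fun _ => c) p :=
  Eventually.of_forall fun _ => contDiffAt_const

theorem SmoothNear.add {f g : C3 → F} (hf : SmoothNear f p) (hg : SmoothNear g p) :
    SmoothNear (fun x => f x + g x) p := by
  filter_upwards [hf, hg] with x h1 h2 using h1.add h2

theorem SmoothNear.sub {f g : C3 → F} (hf : SmoothNear f p) (hg : SmoothNear g p) :
    SmoothNear (fun x => f x - g x) p := by
  filter_upwards [hf, hg] with x h1 h2 using h1.sub h2

theorem SmoothNear.sum {ι : Type*} {s : Finset ι} {f : ι → C3 → F}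
    (hf : ∀ i ∈ s, SmoothNear (f i) p) : SmoothNear (fun x => ∑ i ∈ s, f i x) p := by
  classical
  induction s using Finset.induction_on with
  | empty => simpa using smoothNear_const (0 : F)
  | insert i s hi ih =>
    simp_rw [Finset.sum_insert hi]
    exact (hf i (Finset.mem_insert_self i s)).add
      (ih fun j hj => hf j (Finset.mem_insert_of_mem hj))

theorem SmoothNear.bilin (B : F →L[ℝ] G →L[ℝ] H) {f : C3 → F} {g : C3 → G}
    (hf : SmoothNear f p) (hg : SmoothNear g p) : SmoothNear (fun x => B (f x) (g x)) p := by
  filter_upwards [hf, hg] with x h1 h2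
  exact (B.contDiff.contDiffAt.comp x h1).clm_apply h2

theorem SmoothNear.clm (L : F →L[ℝ] G) {f : C3 → F} (hf : SmoothNear f p) :
    SmoothNear (fun x => L (f x)) p := by
  filter_upwards [hf] with x h1 using L.contDiff.contDiffAt.comp x h1

theorem SmoothNear.smul {a : C3 → ℝ} {f : C3 → F} (ha : SmoothNear a p) (hf : SmoothNear f p) :
    SmoothNear (fun x => a x • f x) p :=
  ha.bilin (ContinuousLinearMap.lsmul ℝ ℝ) hf

theorem SmoothNear.mul {A : Type*} [NormedRing A] [NormedAlgebra ℝ A] {f g : C3 → A}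
    (hf : SmoothNear f p) (hg : SmoothNear g p) : SmoothNear (fun x => f x * g x) p :=
  hf.bilin (ContinuousLinearMap.mul ℝ A) hg

theorem SmoothNear.fderiv {f : C3 → F} (hf : SmoothNear f p) : SmoothNear (fderiv ℝ f) p := by
  filter_upwards [hf] with x hx using hx.fderiv_right (m := ∞) (by simp)

theorem SmoothNear.clm_apply {A : C3 → F →L[ℝ] G} {f : C3 → F} (hA : SmoothNear A p)
    (hf : SmoothNear f p) : SmoothNear (fun x => A x (f x)) p := by
  filter_upwards [hA, hf] with x h1 h2 using h1.clm_apply h2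

theorem SmoothNear.apply {f : C3 → C3} (hf : SmoothNear f p) (m : Fin 3) :
    SmoothNear (fun x => f x m) p :=
  hf.clm (ContinuousLinearMap.proj (R := ℝ) (φ := fun _ : Fin 3 => ℂ) m)

end Smooth

/-! ### Flatness along a family of vector fields. -/

section Flat

variable {F G H : Type*} [NormedAddCommGroup F] [NormedSpace ℝ F] [NormedAddCommGroup G]
  [NormedSpace ℝ G] [NormedAddCommGroup H] [NormedSpace ℝ H] {ι : Type*} {Y : ι → C3 → C3} {p : C3}

/-- `u` and its iterated derivatives of order at most `k` along the vector fields `Y j`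
vanish at `p`. -/
def FlatAt (Y : ι → C3 → C3) (p : C3) : ℕ → (C3 → F) → Prop
  | 0, u => u p = 0
  | k + 1, u => u p = 0 ∧ ∀ j, FlatAt Y p k (fun x => fderiv ℝ u x (Y j x))

theorem FlatAt.apply_eq_zero {k : ℕ} {u : C3 → F} (hu : FlatAt Y p k u) : u p = 0 := by
  cases k with
  | zero => exact hu
  | succ k => exact hu.1

theorem FlatAt.congr {k : ℕ} {u v : C3 → F} (hu : FlatAt Y p k u) (h : u =ᶠ[𝓝 p] v) :
    FlatAt Y p k v := by
  induction k generalizing u v with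
  | zero => exact h.eq_of_nhds.symm.trans hu
  | succ k ih =>
    refine ⟨h.eq_of_nhds.symm.trans hu.1, fun j => ih (hu.2 j) ?_⟩
    filter_upwards [h.fderiv (𝕜 := ℝ)] with x hx
    rw [hx]

theorem FlatAt.of_succ {k : ℕ} {u : C3 → F} (hu : FlatAt Y p (k + 1) u) : FlatAt Y p k u := by
  induction k generalizing u with
  | zero => exact hu.1
  | succ k ih => exact ⟨hu.1, fun j => ih (hu.2 j)⟩

theorem FlatAt.add {k : ℕ} (hY : ∀ j, SmoothNear (Y j) p) {u v : C3 → F} (hus : SmoothNear u p)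
    (hvs : SmoothNear v p) (hu : FlatAt Y p k u) (hv : FlatAt Y p k v) :
    FlatAt Y p k (fun x => u x + v x) := by
  induction k generalizing u v with
  | zero =>
    change u p + v p = 0
    rw [hu.apply_eq_zero, hv.apply_eq_zero, add_zero]
  | succ k ih =>
    refine ⟨by simp only [hu.1, hv.1, add_zero], fun j => ?_⟩
    refine (ih (hus.fderiv.clm_apply (hY j)) (hvs.fderiv.clm_apply (hY j)) (hu.2 j)
      (hv.2 j)).congr ?_
    filter_upwards [hus.eventually_differentiableAt, hvs.eventually_differentiableAt] with x h1 h2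
    rw [fderiv_fun_add h1 h2]
    rfl

/-- Leibniz rule: flat functions form an ideal. All the product rules below are instances. -/
theorem FlatAt.bilin {k : ℕ} (hY : ∀ j, SmoothNear (Y j) p) (B : F →L[ℝ] G →L[ℝ] H) {u : C3 → F}
    {w : C3 → G} (hus : SmoothNear u p) (hws : SmoothNear w p) (hu : FlatAt Y p k u) :
    FlatAt Y p k (fun x => B (u x) (w x)) := by
  induction k generalizing u w with
  | zero =>
    change B (u p) (w p) = 0
    rw [hu.apply_eq_zero, map_zero]
    rfl
  | succ k ih =>
    refine ⟨by simp only [hu.1, map_zero, zero_apply], fun j => ?_⟩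
    have hu' := hus.fderiv.clm_apply (hY j)
    have hw' := hws.fderiv.clm_apply (hY j)
    refine (FlatAt.add hY (hus.bilin B hw') (hu'.bilin B hws) (ih hus hw' hu.of_succ)
      (ih hu' hws (hu.2 j))).congr ?_
    filter_upwards [hus.eventually_differentiableAt, hws.eventually_differentiableAt] with x h1 h2
    rw [B.fderiv_of_bilinear h1 h2]
    simp

theorem FlatAt.smul {k : ℕ} (hY : ∀ j, SmoothNear (Y j) p) {a : C3 → ℝ} {u : C3 → F}
    (has : SmoothNear a p) (hus : SmoothNear u p) (hu : FlatAt Y p k u) :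
    FlatAt Y p k (fun x => a x • u x) :=
  hu.bilin hY (ContinuousLinearMap.lsmul ℝ ℝ).flip hus has

theorem FlatAt.smul_left {k : ℕ} (hY : ∀ j, SmoothNear (Y j) p) {a : C3 → ℝ} {u : C3 → F}
    (has : SmoothNear a p) (hus : SmoothNear u p) (ha : FlatAt Y p k a) :
    FlatAt Y p k (fun x => a x • u x) :=
  ha.bilin hY (ContinuousLinearMap.lsmul ℝ ℝ) has hus

theorem FlatAt.mul_left {k : ℕ} (hY : ∀ j, SmoothNear (Y j) p) {a u : C3 → ℂ}
    (has : SmoothNear a p) (hus : SmoothNear u p) (hu : FlatAt Y p k u) :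
    FlatAt Y p k (fun x => a x * u x) :=
  hu.bilin hY (ContinuousLinearMap.mul ℝ ℂ).flip hus has

theorem FlatAt.clm_apply {k : ℕ} (hY : ∀ j, SmoothNear (Y j) p) {A : C3 → F →L[ℝ] G} {u : C3 → F}
    (hA : SmoothNear A p) (hus : SmoothNear u p) (hu : FlatAt Y p k u) :
    FlatAt Y p k (fun x => A x (u x)) :=
  hu.bilin hY (ContinuousLinearMap.id ℝ (F →L[ℝ] G)).flip hus hA

theorem FlatAt.clm {k : ℕ} (hY : ∀ j, SmoothNear (Y j) p) (L : F →L[ℝ] G) {u : C3 → F}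
    (hus : SmoothNear u p) (hu : FlatAt Y p k u) : FlatAt Y p k (fun x => L (u x)) :=
  hu.clm_apply hY (smoothNear_const L) hus

theorem FlatAt.sum {k : ℕ} (hY : ∀ j, SmoothNear (Y j) p) {κ : Type*} {s : Finset κ}
    {f : κ → C3 → F} (hf : ∀ i ∈ s, SmoothNear (f i) p) (hk : ∀ i ∈ s, FlatAt Y p k (f i)) :
    FlatAt Y p k (fun x => ∑ i ∈ s, f i x) := by
  classical
  induction s using Finset.induction_on with
  | empty =>
    simp only [Finset.sum_empty]
    induction k with
    | zero => rfl
    | succ k ih => exact ⟨rfl, fun j => (ih (by simp)).congr (by simp)⟩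
  | insert i s hi ih =>
    simp_rw [Finset.sum_insert hi]
    exact FlatAt.add hY (hf i (Finset.mem_insert_self i s))
      (SmoothNear.sum fun j hj => hf j (Finset.mem_insert_of_mem hj))
      (hk i (Finset.mem_insert_self i s))
      (ih (fun j hj => hf j (Finset.mem_insert_of_mem hj))
        fun j hj => hk j (Finset.mem_insert_of_mem hj))

/-- The differential of a map which vanishes on `M` kills the tangent vectors of `M`. -/
theorem fderiv_eq_zero_of_mem_tangentSpace {M : Set C3} {q v : C3} (hv : v ∈ tangentSpace M q)
    {u : C3 → F} (hus : SmoothNear u q) (hu : ∀ᶠ x in 𝓝 q, x ∈ M → u x = 0) :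
    fderiv ℝ u q v = 0 := by
  -- Tangent vectors are tested only on real functions, so `u` is composed with real functionals.
  refine SeparatingDual.eq_zero_of_forall_dual_eq_zero (R := ℝ) fun L => ?_
  have h := hv (fun x => L (u x)) (hus.clm L) (hu.mono fun x hx hxM => by rw [hx hxM, map_zero])
  have e := (L.hasFDerivAt.comp q hus.differentiableAt.hasFDerivAt).fderiv
  rw [Function.comp_def] at e
  rwa [e] at h

/-- A function which vanishes on `M` is flat along vector fields tangent to `M`. -/
theorem flatAt_of_vanishing (hY : ∀ j, SmoothNear (Y j) p) {M : Set C3} (hp : p ∈ M)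
    (hYM : ∀ j, ∀ᶠ x in 𝓝 p, x ∈ M → Y j x ∈ tangentSpace M x) {u : C3 → F}
    (hus : SmoothNear u p) (hu : ∀ᶠ x in 𝓝 p, x ∈ M → u x = 0) (k : ℕ) : FlatAt Y p k u := by
  induction k generalizing u with
  | zero => exact hu.self_of_nhds hp
  | succ k ih =>
    refine ⟨hu.self_of_nhds hp, fun j => ih (hus.fderiv.clm_apply (hY j)) ?_⟩
    filter_upwards [hYM j, hus.eventually, hu.eventually_nhds] with x h1 h2 h3 hxM
    exact fderiv_eq_zero_of_mem_tangentSpace (h1 hxM) h2 h3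

/-- A function which vanishes at `p` and is an eigenfunction, with smooth eigenvalues, of the
derivations `Y j` is flat. -/
theorem flatAt_of_fderiv_eq_mul (hY : ∀ j, SmoothNear (Y j) p) {D : C3 → ℂ} (hDs : SmoothNear D p)
    (hD : D p = 0) {h : ι → C3 → ℂ} (hh : ∀ j, SmoothNear (h j) p)
    (hDh : ∀ j, ∀ᶠ x in 𝓝 p, fderiv ℝ D x (Y j x) = h j x * D x) (k : ℕ) : FlatAt Y p k D := by
  induction k with
  | zero => exact hD
  | succ k ih =>
    refine ⟨hD, fun j => (ih.mul_left hY (hh j) hDs).congr ?_⟩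
    filter_upwards [hDh j] with x hx using hx.symm

end Flat
-- Fields tangent to the orbit up to a flat error, and their brackets.
section TangentMod

variable {ι : Type*} [Fintype ι] {Y : ι → C3 → C3} {p : C3}

/-- Near `p`, the vector field `V` is a combination of the `Y j` with smooth coefficients, up to a
vector field which is flat of order `k` along the `Y j`. -/
def TangentMod (Y : ι → C3 → C3) (p : C3) (k : ℕ) (V : C3 → C3) : Prop :=
  ∃ (a : ι → C3 → ℝ) (R : C3 → C3), (∀ j, SmoothNear (a j) p) ∧ SmoothNear R p ∧ FlatAt Y p k R ∧
    V =ᶠ[𝓝 p] fun x => ∑ j, a j x • Y j x + R x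

theorem TangentMod.apply_mem_span {k : ℕ} {V : C3 → C3} (hV : TangentMod Y p k V) :
    V p ∈ Submodule.span ℝ (Set.range fun j => Y j p) := by
  obtain ⟨a, R, -, -, hk, h⟩ := hV
  rw [h.eq_of_nhds, hk.apply_eq_zero, add_zero]
  exact Submodule.sum_mem _ fun j _ => Submodule.smul_mem _ _ (Submodule.subset_span ⟨j, rfl⟩)

theorem fderiv_combination {a : ι → C3 → ℝ} {x : C3} (ha : ∀ j, DifferentiableAt ℝ (a j) x)
    (hY : ∀ j, DifferentiableAt ℝ (Y j) x) (v : C3) :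
    fderiv ℝ (fun x => ∑ j, a j x • Y j x) x v =
      ∑ j, (fderiv ℝ (a j) x v) • Y j x + ∑ j, a j x • fderiv ℝ (Y j) x v := by
  rw [(HasFDerivAt.fun_sum fun j _ => (ha j).hasFDerivAt.fun_smul (hY j).hasFDerivAt).fderiv]
  simp [Finset.sum_add_distrib, add_comm]

theorem lieBracket_combination {a b : ι → C3 → ℝ} {x : C3} (ha : ∀ j, DifferentiableAt ℝ (a j) x)
    (hb : ∀ j, DifferentiableAt ℝ (b j) x) (hY : ∀ j, DifferentiableAt ℝ (Y j) x)
    {c : ι → ι → ι → ℝ}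
    (hc : ∀ i j, VectorField.lieBracket ℝ (Y i) (Y j) x = ∑ m, c i j m • Y m x) :
    VectorField.lieBracket ℝ (fun x => ∑ j, a j x • Y j x) (fun x => ∑ j, b j x • Y j x) x =
      ∑ m, (fderiv ℝ (b m) x (∑ j, a j x • Y j x) - fderiv ℝ (a m) x (∑ j, b j x • Y j x) +
        ∑ i, ∑ j, a i x * b j x * c i j m) • Y m x := by
  have key : ∑ m, (∑ i, ∑ j, a i x * b j x * c i j m) • Y m x =
      ∑ i, ∑ j, (a i x * b j x) • (fderiv ℝ (Y j) x (Y i x) - fderiv ℝ (Y i) x (Y j x)) := by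
    simp_rw [Finset.sum_smul]
    rw [Finset.sum_comm]
    refine Finset.sum_congr rfl fun i _ => ?_
    rw [Finset.sum_comm]
    refine Finset.sum_congr rfl fun j _ => ?_
    have := hc i j
    rw [VectorField.lieBracket] at this
    rw [this, Finset.smul_sum]
    simp_rw [mul_smul]
  rw [VectorField.lieBracket, fderiv_combination hb hY, fderiv_combination ha hY]
  simp_rw [add_smul, sub_smul, Finset.sum_add_distrib, Finset.sum_sub_distrib]
  rw [key]
  simp_rw [smul_sub, Finset.sum_sub_distrib, map_sum, map_smul, Finset.smul_sum, smul_smul]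
  rw [Finset.sum_comm (f := fun i j => (a i x * b j x) • fderiv ℝ (Y j) x (Y i x))]
  simp_rw [mul_comm (b _ x) (a _ x)]
  abel

/-- The bracket of two combinations of the `Y j` is again one, by closure under brackets. The error
terms contain a remainder `R` or `S`, differentiated at most once, and along a combination of the `Y
j` unless the other factor is itself flat; hence the loss of a single order. -/
theorem TangentMod.lieBracket (hY : ∀ j, SmoothNear (Y j) p)
    (hc : ∃ c : ι → ι → ι → ℝ, ∀ i j,
      VectorField.lieBracket ℝ (Y i) (Y j) =ᶠ[𝓝 p] fun x => ∑ m, c i j m • Y m x)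
    {k : ℕ} {V W : C3 → C3} (hV : TangentMod Y p (k + 1) V) (hW : TangentMod Y p (k + 1) W) :
    TangentMod Y p k (VectorField.lieBracket ℝ V W) := by
  obtain ⟨c, hc⟩ := hc
  obtain ⟨a, R, ha, hR, hRk, hVe⟩ := hV
  obtain ⟨b, S, hb, hS, hSk, hWe⟩ := hW
  have flat_along : ∀ {a : ι → C3 → ℝ} {R : C3 → C3}, (∀ j, SmoothNear (a j) p) →
      SmoothNear R p → FlatAt Y p (k + 1) R →
      FlatAt Y p k (fun x => fderiv ℝ R x (∑ j, a j x • Y j x)) := by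
    intro a R ha hR hRk
    refine (FlatAt.sum hY (s := Finset.univ)
      (fun j _ => (ha j).smul (hR.fderiv.clm_apply (hY j)))
      (fun j _ => (hRk.2 j).smul hY (ha j) (hR.fderiv.clm_apply (hY j)))).congr ?_
    exact Eventually.of_forall fun x => by simp
  set A : C3 → C3 := fun x => ∑ j, a j x • Y j x with hA
  set B : C3 → C3 := fun x => ∑ j, b j x • Y j x with hB
  have hAs : SmoothNear A p := SmoothNear.sum fun j _ => (ha j).smul (hY j)
  have hBs : SmoothNear B p := SmoothNear.sum fun j _ => (hb j).smul (hY j)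
  have neg : ∀ {u : C3 → C3}, SmoothNear u p → FlatAt Y p k u → FlatAt Y p k (fun x => -u x) :=
    fun hu h => h.clm hY (-ContinuousLinearMap.id ℝ C3) hu
  -- `[A + R, B + S] - [A, B]` is the sum of the three terms `s` minus the sum of the three terms
  -- `t`. Only `s2` and `t2` use up an order of flatness.
  have s1 := hBs.fderiv.clm_apply hR
  have s2 := hS.fderiv.clm_apply hAs
  have s3 := hS.fderiv.clm_apply hR
  have t1 := hAs.fderiv.clm_apply hS
  have t2 := hR.fderiv.clm_apply hBs
  have t3 := hR.fderiv.clm_apply hS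
  have hs := (s1.add s2).add s3
  have ht := (t1.add t2).add t3
  have fs := FlatAt.add hY (s1.add s2) s3
    (FlatAt.add hY s1 s2 (hRk.of_succ.clm_apply hY hBs.fderiv hR) (flat_along ha hS hSk))
    (hRk.of_succ.clm_apply hY hS.fderiv hR)
  have ft := FlatAt.add hY (t1.add t2) t3
    (FlatAt.add hY t1 t2 (hSk.of_succ.clm_apply hY hAs.fderiv hS) (flat_along hb hR hRk))
    (hSk.of_succ.clm_apply hY hR.fderiv hS)
  have ht' := ht.clm (-ContinuousLinearMap.id ℝ C3)
  refine ⟨fun m x => fderiv ℝ (b m) x (A x) - fderiv ℝ (a m) x (B x) +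
      ∑ i, ∑ j, a i x * b j x * c i j m, _, fun m => ?_, hs.add ht',
      FlatAt.add hY hs ht' fs (neg ht ft), ?_⟩
  · refine (((hb m).fderiv.clm_apply hAs).sub ((ha m).fderiv.clm_apply hBs)).add ?_
    exact SmoothNear.sum fun i _ => SmoothNear.sum fun j _ =>
      ((ha i).mul (hb j)).mul (smoothNear_const _)
  · refine (hVe.lieBracket_vectorField hWe).trans ?_
    filter_upwards [eventually_all.2 fun j => (ha j).eventually_differentiableAt,
      eventually_all.2 fun j => (hb j).eventually_differentiableAt,
      eventually_all.2 fun j => (hY j).eventually_differentiableAt,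
      eventually_all.2 fun i => eventually_all.2 fun j => hc i j,
      hAs.eventually_differentiableAt, hBs.eventually_differentiableAt,
      hR.eventually_differentiableAt, hS.eventually_differentiableAt]
      with x h1 h2 h3 h4 h5 h6 h7 h8
    have e := lieBracket_combination h1 h2 h3 h4
    rw [← hA, ← hB] at e
    rw [← e, VectorField.lieBracket, VectorField.lieBracket, fderiv_fun_add h5 h7,
      fderiv_fun_add h6 h8]
    simp only [add_apply, map_add, neg_apply,
      ContinuousLinearMap.id_apply]
    abel

end TangentMod
-- The complex determinant and its derivatives along the fields.
section Det

/-- The determinant of three vectors of `ℂ³`. -/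
def det3 (u v w : C3) : ℂ :=
  u 0 * (v 1 * w 2 - v 2 * w 1) - u 1 * (v 0 * w 2 - v 2 * w 0) + u 2 * (v 0 * w 1 - v 1 * w 0)

theorem linearIndependent_iff_det3_ne_zero {u v w : C3} :
    LinearIndependent ℂ ![u, v, w] ↔ det3 u v w ≠ 0 := by
  have h := Matrix.linearIndependent_rows_iff_isUnit (K := ℂ) (A := Matrix.of ![u, v, w])
  rw [Matrix.isUnit_iff_isUnit_det, Matrix.det_fin_three, isUnit_iff_ne_zero] at h
  change LinearIndependent ℂ ![u, v, w] ↔ _ at h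
  rw [h]
  refine not_congr (Eq.congr ?_ rfl)
  simp [det3]
  ring

theorem SmoothNear.det3 {p : C3} {U V W : C3 → C3} (hU : SmoothNear U p) (hV : SmoothNear V p)
    (hW : SmoothNear W p) : SmoothNear (fun x => det3 (U x) (V x) (W x)) p :=
  (((hU.apply 0).mul (((hV.apply 1).mul (hW.apply 2)).sub ((hV.apply 2).mul (hW.apply 1)))).sub
    ((hU.apply 1).mul (((hV.apply 0).mul (hW.apply 2)).sub ((hV.apply 2).mul (hW.apply 0))))).add
    ((hU.apply 2).mul (((hV.apply 0).mul (hW.apply 1)).sub ((hV.apply 1).mul (hW.apply 0))))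

theorem fderiv_det3 {U V W : C3 → C3} {x : C3} (hU : DifferentiableAt ℝ U x)
    (hV : DifferentiableAt ℝ V x) (hW : DifferentiableAt ℝ W x) (t : C3) :
    fderiv ℝ (fun x => det3 (U x) (V x) (W x)) x t =
      det3 (fderiv ℝ U x t) (V x) (W x) + det3 (U x) (fderiv ℝ V x t) (W x) +
        det3 (U x) (V x) (fderiv ℝ W x t) := by
  have cu := hasFDerivAt_pi'.1 hU.hasFDerivAt
  have cv := hasFDerivAt_pi'.1 hV.hasFDerivAt
  have cw := hasFDerivAt_pi'.1 hW.hasFDerivAt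
  have h := ((((cu 0).fun_mul (((cv 1).fun_mul (cw 2)).fun_sub ((cv 2).fun_mul (cw 1)))).fun_sub
    ((cu 1).fun_mul (((cv 0).fun_mul (cw 2)).fun_sub ((cv 2).fun_mul (cw 0))))).fun_add
    ((cu 2).fun_mul (((cv 0).fun_mul (cw 1)).fun_sub ((cv 1).fun_mul (cw 0))))).fderiv
  simp only [det3]
  rw [h]
  simp
  ring

/-- Infinitesimal form of the multiplicativity of the determinant; the sum is the complex trace of
`L`. -/
theorem det3_trace (L : C3 →L[ℂ] C3) (u v w : C3) :
    det3 (L u) v w + det3 u (L v) w + det3 u v (L w) =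
      (∑ m, L (Pi.single m 1) m) * det3 u v w := by
  have h : ∀ (y : C3) (i : Fin 3), L y i = ∑ m, y m * L (Pi.single m 1) i := by
    intro y i
    conv_lhs => rw [pi_eq_sum_univ' y]
    simp
  simp only [det3, h u, h v, h w, Fin.sum_univ_three]
  ring

/-- The derivative of `Y j` along `Y i` is `[Y i, Y j]` plus the differential of `Y i` applied to `Y
j`. The brackets contribute the trace of `ad (Y i)`, the other terms vanishing by repeated columns.
The differential is `ℂ`-linear because `Y i` is holomorphic, so it contributes its complex trace. -/
theorem fderiv_det3_along {Y : Fin 3 → C3 → C3} {x : C3} (hY : ∀ j, DifferentiableAt ℂ (Y j) x)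
    {c : Fin 3 → Fin 3 → Fin 3 → ℝ}
    (hc : ∀ i j, VectorField.lieBracket ℝ (Y i) (Y j) x = ∑ m, c i j m • Y m x) (i : Fin 3) :
    fderiv ℝ (fun x => det3 (Y 0 x) (Y 1 x) (Y 2 x)) x (Y i x) =
      (∑ m, ((c i m m : ℝ) : ℂ) + ∑ m, fderiv ℝ (Y i) x (Pi.single m 1) m) *
        det3 (Y 0 x) (Y 1 x) (Y 2 x) := by
  have hR : ∀ j, DifferentiableAt ℝ (Y j) x := fun j => (hY j).restrictScalars ℝ
  have hd : ∀ j, fderiv ℝ (Y j) x (Y i x) =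
      ∑ m, c i j m • Y m x + fderiv ℂ (Y i) x (Y j x) := by
    intro j
    rw [← hc, VectorField.lieBracket, (hY i).fderiv_restrictScalars ℝ]
    simp
  have ht := det3_trace (fderiv ℂ (Y i) x) (Y 0 x) (Y 1 x) (Y 2 x)
  have hm : ∀ v, fderiv ℝ (Y i) x v = fderiv ℂ (Y i) x v := fun v => by
    rw [(hY i).fderiv_restrictScalars ℝ]; rfl
  rw [fderiv_det3 (hR 0) (hR 1) (hR 2), hd, hd, hd, add_mul]
  simp_rw [hm]
  rw [← ht]
  simp only [det3, Fin.sum_univ_three, Pi.add_apply, Pi.smul_apply, Complex.real_smul]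
  ring

end Det

/-! ### Tangent spaces of `M` and smooth coefficients in a frame. -/

section TangentSpace

/-- A function vanishing on `M` has a constrained extremum at `q`, so Lagrange multipliers relate
its differential to that of `ρ`; surjectivity of the latter makes the multiplier `Λ₀` nonzero. -/
theorem tangentSpace_eq_ker {M : Set C3} {q : C3} {U : Set C3} {ρ : C3 → (Fin 2 → ℝ)}
    (hq : q ∈ M) (hU : IsOpen U) (hqU : q ∈ U) (hρ : AnalyticOnNhd ℝ ρ U)
    (hM : ∀ x ∈ U, x ∈ M ↔ ρ x = 0) (hs : Function.Surjective (fderiv ℝ ρ q)) :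
    tangentSpace M q = (fderiv ℝ ρ q).toLinearMap.ker := by
  have hUq : U ∈ 𝓝 q := hU.mem_nhds hqU
  have hρ0 : ρ q = 0 := (hM q hqU).1 hq
  ext v
  constructor
  · intro hv
    refine fderiv_eq_zero_of_mem_tangentSpace hv ?_ ?_
    · filter_upwards [hUq] with x hx using (hρ x hx).contDiffAt
    · filter_upwards [hUq] with x hx hxM using (hM x hx).1 hxM
  · intro hv f hf hf0
    have hex : IsLocalExtrOn f {x | ρ x = ρ q} q := by
      left
      filter_upwards [mem_nhdsWithin_of_mem_nhds hUq, self_mem_nhdsWithin,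
        mem_nhdsWithin_of_mem_nhds hf0] with x hxU hx hfx
      rw [hf0.self_of_nhds hq, hfx ((hM x hxU).2 (hx.trans hρ0))]
    obtain ⟨Λ, Λ₀, hne, h⟩ := hex.exists_linear_map_of_hasStrictFDerivAt
      ((hρ q hqU).contDiffAt (n := 1)|>.hasStrictFDerivAt (by simp))
      (hf.self_of_nhds.hasStrictFDerivAt (by simp))
    have hΛ₀ : Λ₀ ≠ 0 := by
      rintro rfl
      refine hne (Prod.ext (LinearMap.ext fun y => ?_) rfl)
      obtain ⟨x, rfl⟩ := hs y
      simpa using h x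
    have hv' : fderiv ℝ ρ q v = 0 := hv
    have := h v
    rw [hv', map_zero, zero_add] at this
    exact (smul_eq_zero.1 this).resolve_left hΛ₀

theorem IsGenericCRSubmanifold.finrank_tangentSpace {M : Set C3} (hM : IsGenericCRSubmanifold M)
    {q : C3} (hq : q ∈ M) : Module.finrank ℝ (tangentSpace M q) = 4 := by
  obtain ⟨U, ρ, hU, hqU, hρ, hMρ, hs⟩ := hM.isSubmanifold q hq
  rw [tangentSpace_eq_ker hq hU hqU hρ hMρ (hs q hqU hq)]
  have h := (fderiv ℝ ρ q).toLinearMap.finrank_range_add_finrank_ker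
  rw [LinearMap.range_eq_top.2 (hs q hqU hq), finrank_top, Module.finrank_fin_fun,
    Module.finrank_pi_fintype] at h
  simp [Complex.finrank_real_complex] at h
  omega

/-- A vector field tangent to `M` is a smooth combination on `M` of a frame of `M`. -/
theorem exists_smooth_coefficients {M : Set C3} {p : C3} {n : ℕ}
    (hdim : ∀ q ∈ M, Module.finrank ℝ (tangentSpace M q) = n) {X : Fin n → C3 → C3}
    (hX : ∀ j, SmoothNear (X j) p)
    (hXM : ∀ j, ∀ᶠ x in 𝓝 p, x ∈ M → X j x ∈ tangentSpace M x)
    (hXp : LinearIndependent ℝ fun j => X j p) {V : C3 → C3} (hV : SmoothNear V p)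
    (hVM : ∀ᶠ x in 𝓝 p, x ∈ M → V x ∈ tangentSpace M x) :
    ∃ a : Fin n → C3 → ℝ, (∀ j, SmoothNear (a j) p) ∧
      ∀ᶠ x in 𝓝 p, x ∈ M → V x = ∑ j, a j x • X j x := by
  let E := Fin n → ℝ
  let B : C3 → E →L[ℝ] C3 := fun x =>
    ∑ j, (ContinuousLinearMap.proj (R := ℝ) (φ := fun _ : Fin n => ℝ) j).smulRight (X j x)
  have hB : ∀ x α, B x α = ∑ j, α j • X j x := fun x α => by
    simp [B]
    rfl
  have hBs : SmoothNear B p := SmoothNear.sum fun j _ =>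
    (hX j).clm (ContinuousLinearMap.smulRightL ℝ E C3
      (ContinuousLinearMap.proj (R := ℝ) (φ := fun _ : Fin n => ℝ) j))
  have hBp : (B p).toLinearMap.ker = ⊥ := by
    rw [LinearMap.ker_eq_bot']
    intro α hα
    have : B p α = 0 := hα
    rw [hB] at this
    exact funext fun j => Fintype.linearIndependent_iff.1 hXp α this j
  -- A left inverse `L` of the frame map `B p` makes `L ∘ B x` invertible for `x` near `p`; the
  -- coefficients are `(L ∘ B x)⁻¹ (L (V x))`. They recover `V x` on `M`, where `V x` lies in the
  -- range of `B x`.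
  obtain ⟨L₀, hL₀⟩ := LinearMap.exists_leftInverse_of_injective _ hBp
  let L : C3 →L[ℝ] E := LinearMap.toContinuousLinearMap L₀
  let C : C3 → E →L[ℝ] E := fun x => L ∘L B x
  have hC : SmoothNear C p := hBs.clm (ContinuousLinearMap.compL ℝ E C3 E L)
  have hCp : C p = 1 := ContinuousLinearMap.ext fun α => LinearMap.congr_fun hL₀ α
  have hCu : ∀ᶠ x in 𝓝 p, IsUnit (C x) := by
    refine hC.differentiableAt.continuousAt.eventually_mem (Units.isOpen.mem_nhds ?_)
    rw [hCp]
    exact isUnit_one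
  have hinv : SmoothNear (fun x => Ring.inverse (C x)) p := by
    filter_upwards [hC, hCu] with x hx ⟨u, hu⟩
    exact ContDiffAt.comp x (hu ▸ contDiffAt_ringInverse ℝ u) hx
  have ha := hinv.clm_apply (hV.clm L)
  refine ⟨fun j x => Ring.inverse (C x) (L (V x)) j, fun j =>
    ha.clm (ContinuousLinearMap.proj (R := ℝ) (φ := fun _ : Fin n => ℝ) j), ?_⟩
  filter_upwards [hCu, hVM, eventually_all.2 hXM] with x hu hVx hXx hxM
  have hcancel : ∀ α, Ring.inverse (C x) (L (B x α)) = α := fun α =>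
    DFunLike.congr_fun (Ring.inverse_mul_cancel _ hu) α
  have hle : (B x).toLinearMap.range ≤ tangentSpace M x := by
    rintro _ ⟨α, rfl⟩
    change B x α ∈ _
    rw [hB]
    exact Submodule.sum_mem _ fun j _ => Submodule.smul_mem _ _ (hXx j hxM)
  have hinj : Function.Injective (B x).toLinearMap := fun α β h => by
    rw [← hcancel α, ← hcancel β]
    exact congrArg (fun y => Ring.inverse (C x) (L y)) h
  have heq : (B x).toLinearMap.range = tangentSpace M x :=
    Submodule.eq_of_le_of_finrank_eq hle (by
      rw [hdim x hxM, LinearMap.finrank_range_of_inj hinj, Module.finrank_fin_fun])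
  obtain ⟨α, hα⟩ : V x ∈ (B x).toLinearMap.range := heq ▸ hVx hxM
  have hα' : B x α = V x := hα
  rw [← hα', hcancel, hB]

end TangentSpace
-- Sections of `T^ℂ M` and the contradiction with total non-degeneracy.
section Core

/-- Cramer's rule for the complex relation between four vectors `x j` provided by a vector
`∑ a j • x j` such that `i ∑ a j • x j = ∑ b j • x j`. -/
theorem cramer_relation {x : Fin 4 → C3} {a b : Fin 4 → ℝ}
    (h : ∑ j, b j • x j = Complex.I • ∑ j, a j • x j) :
    ((b 3 : ℂ) - Complex.I * a 3) * det3 (x 0) (x 1) (x 3) =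
      -(((b 2 : ℂ) - Complex.I * a 2) * det3 (x 0) (x 1) (x 2)) := by
  have h0 := congrFun h 0
  have h1 := congrFun h 1
  have h2 := congrFun h 2
  simp only [Fin.sum_univ_four, Pi.add_apply, Pi.smul_apply, Complex.real_smul, smul_eq_mul]
    at h0 h1 h2
  simp only [det3]
  -- The relation is fed into `det3 (x 0) (x 1)`, which kills the terms in `x 0` and `x 1`.
  linear_combination (x 0 1 * x 1 2 - x 1 1 * x 0 2) * h0 - (x 0 0 * x 1 2 - x 1 0 * x 0 2) * h1 +
    (x 0 0 * x 1 1 - x 1 0 * x 0 1) * h2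

theorem linearIndependent_frame {M : Set C3} (hM : IsGenericCRSubmanifold M) {p : C3} (hp : p ∈ M)
    {y : Fin 3 → C3} {z : C3} (hy : ∀ j, y j ∈ tangentSpace M p) (hz : z ∈ tangentSpace M p)
    (hspan : tangentSpace M p ≤ Submodule.span ℝ (insert z (Set.range y))) :
    LinearIndependent ℝ ![y 0, y 1, y 2, z] := by
  have hr : Set.range ![y 0, y 1, y 2, z] = insert z (Set.range y) := by
    ext v
    simp only [Set.mem_range, Set.mem_insert_iff, Fin.exists_fin_succ]
    simp [eq_comm]
    tauto
  have heq : Submodule.span ℝ (insert z (Set.range y)) = tangentSpace M p :=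
    le_antisymm (Submodule.span_le.2 (Set.insert_subset hz (Set.range_subset_iff.2 hy))) hspan
  rw [linearIndependent_iff_card_eq_finrank_span, Set.finrank, hr, heq, hM.finrank_tangentSpace hp]
  rfl

variable {M : Set C3} {p : C3} {Y : Fin 3 → C3 → C3} {Z : C3 → C3}

/-- If `Y 0, Y 1, Y 2` are linearly dependent over `ℂ` at `p`, then, up to terms which are flat along
the `Y j`, the sections of `T^ℂ M` are combinations of the `Y j`. -/
theorem tangentMod_of_mem_complexTangentSections (hM : IsGenericCRSubmanifold M) (hp : p ∈ M)
    (hY : ∀ j, AnalyticAt ℂ (Y j) p) (hZ : SmoothNear Z p)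
    (hYM : ∀ j, ∀ᶠ x in 𝓝 p, x ∈ M → Y j x ∈ tangentSpace M x)
    (hZM : ∀ᶠ x in 𝓝 p, x ∈ M → Z x ∈ tangentSpace M x)
    (hspan : tangentSpace M p ≤ Submodule.span ℝ (insert (Z p) (Set.range fun j => Y j p)))
    (hc : ∃ c : Fin 3 → Fin 3 → Fin 3 → ℝ, ∀ i j,
      VectorField.lieBracket ℝ (Y i) (Y j) =ᶠ[𝓝 p] fun x => ∑ m, c i j m • Y m x)
    (hD : det3 (Y 0 p) (Y 1 p) (Y 2 p) = 0) (hΔ : det3 (Y 0 p) (Y 1 p) (Z p) ≠ 0)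
    {V : C3 → C3} (hV : V ∈ complexTangentSections M p) (k : ℕ) : TangentMod Y p k V := by
  obtain ⟨c, hc⟩ := hc
  have hYs : ∀ j, SmoothNear (Y j) p := fun j =>
    (hY j).eventually_analyticAt.mono fun x hx => contDiffAt_of_analyticAt hx
  have hfr := linearIndependent_frame hM hp (fun j => (hYM j).self_of_nhds hp)
    (hZM.self_of_nhds hp) hspan
  let X : Fin 4 → C3 → C3 := ![Y 0, Y 1, Y 2, Z]
  have hXs : ∀ j, SmoothNear (X j) p := by
    simp only [Fin.forall_fin_succ]
    exact ⟨hYs 0, hYs 1, hYs 2, hZ, fun i => i.elim0⟩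
  have hXM : ∀ j, ∀ᶠ x in 𝓝 p, x ∈ M → X j x ∈ tangentSpace M x := by
    rw [Fin.forall_fin_succ, Fin.forall_fin_succ, Fin.forall_fin_succ, Fin.forall_fin_succ]
    exact ⟨hYM 0, hYM 1, hYM 2, hZM, fun i => i.elim0⟩
  have hXp : LinearIndependent ℝ fun j => X j p := by
    convert hfr using 1
    funext j
    fin_cases j <;> rfl
  have hdim : ∀ q ∈ M, Module.finrank ℝ (tangentSpace M q) = 4 :=
    fun q hq => hM.finrank_tangentSpace hq
  have hIV : SmoothNear (fun x => Complex.I • V x) p :=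
    hV.1.clm (Complex.I • ContinuousLinearMap.id ℝ C3)
  obtain ⟨a, ha, haV⟩ := exists_smooth_coefficients hdim hXs hXM hXp hV.1
    (hV.2.mono fun x hx hxM => (hx hxM).1)
  obtain ⟨b, hb, hbV⟩ := exists_smooth_coefficients hdim hXs hXM hXp hIV
    (hV.2.mono fun x hx hxM => (hx hxM).2)
  have hDs := (hYs 0).det3 (hYs 1) (hYs 2)
  have hΔs := (hYs 0).det3 (hYs 1) hZ
  have hDflat : FlatAt Y p k fun x => det3 (Y 0 x) (Y 1 x) (Y 2 x) := by
    refine flatAt_of_fderiv_eq_mul hYs hDs hD (h := fun i x =>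
      ∑ m, ((c i m m : ℝ) : ℂ) + ∑ m, fderiv ℝ (Y i) x (Pi.single m 1) m) (fun i => ?_)
      (fun i => ?_) k
    · exact (smoothNear_const _).add (SmoothNear.sum fun m _ =>
        ((hYs i).fderiv.clm_apply (smoothNear_const (Pi.single m (1 : ℂ) : C3))).apply m)
    · filter_upwards [eventually_all.2 fun j => (hY j).eventually_analyticAt,
        eventually_all.2 fun i => eventually_all.2 fun j => hc i j] with x h1 h2
      exact fderiv_det3_along (fun j => (h1 j).differentiableAt) h2 i
  have hinv : SmoothNear (fun x => (det3 (Y 0 x) (Y 1 x) (Z x))⁻¹) p := by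
    filter_upwards [hΔs, hΔs.differentiableAt.continuousAt.eventually_ne hΔ] with x h1 h2
    exact h1.inv h2
  have cs : ∀ j, SmoothNear (fun x => (b j x : ℂ) - Complex.I * a j x) p := fun j =>
    ((hb j).clm Complex.ofRealCLM).sub ((smoothNear_const Complex.I).mul
      ((ha j).clm Complex.ofRealCLM))
  have hms := (cs 2).mul hinv
  -- Cramer's relation divided by `Δ`. It holds only on `M`, but this suffices for flatness since
  -- the `Y j` are tangent to `M`; the term with factor `D` is flat and can be removed.
  have hrel : ∀ᶠ x in 𝓝 p, x ∈ M → ((b 3 x : ℂ) - Complex.I * a 3 x) +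
      ((b 2 x : ℂ) - Complex.I * a 2 x) * (det3 (Y 0 x) (Y 1 x) (Z x))⁻¹ *
        det3 (Y 0 x) (Y 1 x) (Y 2 x) = 0 := by
    filter_upwards [haV, hbV, hΔs.differentiableAt.continuousAt.eventually_ne hΔ]
      with x h1 h2 h3 hxM
    have h := cramer_relation (x := fun j => X j x) (a := fun j => a j x) (b := fun j => b j x)
      (by rw [← h1 hxM, ← h2 hxM])
    change _ * det3 (Y 0 x) (Y 1 x) (Z x) = -(_ * det3 (Y 0 x) (Y 1 x) (Y 2 x)) at h
    field_simp
    linear_combination h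
  have hms' := hms.mul hDs
  have hcflat : FlatAt Y p k fun x => (b 3 x : ℂ) - Complex.I * a 3 x := by
    have h1 := flatAt_of_vanishing hYs hp hYM ((cs 3).add hms') hrel k
    have h2 := (hDflat.mul_left hYs hms hDs).clm hYs (-ContinuousLinearMap.id ℝ ℂ) hms'
    refine (FlatAt.add hYs ((cs 3).add hms') (hms'.clm _) h1 h2).congr ?_
    exact Eventually.of_forall fun x => by
      simp only [neg_apply, ContinuousLinearMap.id_apply]
      ring
  -- As `a 3` and `b 3` are real, `a 3 = -Im (b 3 - i a 3)`.
  have haflat : FlatAt Y p k (a 3) := by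
    refine (hcflat.clm hYs (-Complex.imCLM) (cs 3)).congr ?_
    exact Eventually.of_forall fun x => by simp
  have hcomb : SmoothNear (fun x => ∑ j, a j x • X j x) p :=
    SmoothNear.sum fun j _ => (ha j).smul (hXs j)
  have hR := hV.1.sub hcomb
  have hRflat := flatAt_of_vanishing hYs hp hYM hR
    (haV.mono fun x hx hxM => by rw [hx hxM, sub_self]) k
  -- The remainder is `a 3 • Z` plus the defect of the frame expansion off `M`; both are flat.
  refine ⟨![a 0, a 1, a 2], _, ?_, hR.add ((ha 3).smul hZ), FlatAt.add hYs hR ((ha 3).smul hZ)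
    hRflat (haflat.smul_left hYs (ha 3) hZ), ?_⟩
  · simp only [Fin.forall_fin_succ]
    exact ⟨ha 0, ha 1, ha 2, fun i => i.elim0⟩
  · refine Eventually.of_forall fun x => ?_
    simp [Fin.sum_univ_three, Fin.sum_univ_four, X]
    abel

/-- The same Cramer argument at the single point `p`, which avoids extending a complex tangent
vector to a section. -/
theorem complexTangentSpace_le_span {y : Fin 3 → C3} {z : C3}
    (hspan : tangentSpace M p ≤ Submodule.span ℝ (insert z (Set.range y)))
    (hD : det3 (y 0) (y 1) (y 2) = 0) (hΔ : det3 (y 0) (y 1) z ≠ 0) :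
    complexTangentSpace M p ≤ Submodule.span ℝ (Set.range y) := by
  have hco : ∀ v ∈ tangentSpace M p, ∃ a : Fin 4 → ℝ,
      v = ∑ j, a j • (![y 0, y 1, y 2, z] : Fin 4 → C3) j := by
    intro v hv
    obtain ⟨t, w, hw, rfl⟩ := Submodule.mem_span_insert.1 (hspan hv)
    obtain ⟨a, rfl⟩ := (Submodule.mem_span_range_iff_exists_fun ℝ).1 hw
    refine ⟨![a 0, a 1, a 2, t], ?_⟩
    simp [Fin.sum_univ_three, Fin.sum_univ_four]
    abel
  rintro v ⟨hv, hiv⟩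
  obtain ⟨a, ha⟩ := hco v hv
  obtain ⟨b, hb⟩ := hco _ hiv
  have h := cramer_relation (hb.symm.trans (congrArg (Complex.I • ·) ha))
  change _ * det3 (y 0) (y 1) z = -(_ * det3 (y 0) (y 1) (y 2)) at h
  rw [hD, mul_zero, neg_zero] at h
  have h3 := congrArg Complex.im ((mul_eq_zero.1 h).resolve_right hΔ)
  have ha3 : a 3 = 0 := by simpa using h3
  rw [Submodule.mem_span_range_iff_exists_fun]
  refine ⟨![a 0, a 1, a 2], ?_⟩
  rw [ha]
  simp [Fin.sum_univ_three, Fin.sum_univ_four, ha3]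

theorem det3_ne_zero_of_frame (hM : IsGenericCRSubmanifold M) (hp : p ∈ M)
    (hnd : IsTotallyNondegenerateAt M p)
    (hY : ∀ j, AnalyticAt ℂ (Y j) p) (hZ : SmoothNear Z p)
    (hYM : ∀ j, ∀ᶠ x in 𝓝 p, x ∈ M → Y j x ∈ tangentSpace M x)
    (hZM : ∀ᶠ x in 𝓝 p, x ∈ M → Z x ∈ tangentSpace M x)
    (hspan : tangentSpace M p ≤ Submodule.span ℝ (insert (Z p) (Set.range fun j => Y j p)))
    (hc : ∃ c : Fin 3 → Fin 3 → Fin 3 → ℝ, ∀ i j,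
      VectorField.lieBracket ℝ (Y i) (Y j) =ᶠ[𝓝 p] fun x => ∑ m, c i j m • Y m x)
    (hΔ : det3 (Y 0 p) (Y 1 p) (Z p) ≠ 0) : det3 (Y 0 p) (Y 1 p) (Y 2 p) ≠ 0 := by
  intro hD
  have hYs : ∀ j, SmoothNear (Y j) p := fun j =>
    (hY j).eventually_analyticAt.mono fun x hx => contDiffAt_of_analyticAt hx
  have hsec : ∀ {V}, V ∈ complexTangentSections M p → ∀ k, TangentMod Y p k V := fun hV k =>
    tangentMod_of_mem_complexTangentSections hM hp hY hZ hYM hZM hspan hc hD hΔ hV k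
  have hle : tangentSpace M p ≤ Submodule.span ℝ (Set.range fun j => Y j p) := by
    rw [← hnd]
    refine sup_le (sup_le (complexTangentSpace_le_span hspan hD hΔ) ?_) ?_
    · rw [bracketSpace, Submodule.span_le]
      rintro _ ⟨V, hV, W, hW, rfl⟩
      -- Order 1 suffices for single brackets; double ones need order 2 in the inner bracket.
      exact ((hsec hV 1).lieBracket hYs hc (hsec hW 1)).apply_mem_span
    · rw [doubleBracketSpace, Submodule.span_le]
      rintro _ ⟨U, hU, V, hV, W, hW, rfl⟩
      exact ((hsec hU 1).lieBracket hYs hc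
        ((hsec hV 2).lieBracket hYs hc (hsec hW 2))).apply_mem_span
  have h1 := Submodule.finrank_mono hle
  have h2 := finrank_range_le_card (R := ℝ) (fun j => Y j p)
  rw [hM.finrank_tangentSpace hp] at h1
  rw [Set.finrank, Fintype.card_fin] at h2
  omega

/-- If the tangent vector fields `Y 0, Y 1, Y 2` span a Lie algebra and can be completed to a frame
of a totally non-degenerate `M`, then they are linearly independent over `ℂ`. -/
theorem linearIndependent_of_frame (hM : IsGenericCRSubmanifold M) (hp : p ∈ M)
    (hnd : IsTotallyNondegenerateAt M p)
    (hY : ∀ j, AnalyticAt ℂ (Y j) p) (hZ : SmoothNear Z p)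
    (hYM : ∀ j, ∀ᶠ x in 𝓝 p, x ∈ M → Y j x ∈ tangentSpace M x)
    (hZM : ∀ᶠ x in 𝓝 p, x ∈ M → Z x ∈ tangentSpace M x)
    (hspan : tangentSpace M p ≤ Submodule.span ℝ (insert (Z p) (Set.range fun j => Y j p)))
    (hc : ∃ c : Fin 3 → Fin 3 → Fin 3 → ℝ, ∀ i j,
      VectorField.lieBracket ℝ (Y i) (Y j) =ᶠ[𝓝 p] fun x => ∑ m, c i j m • Y m x) :
    LinearIndependent ℂ fun j => Y j p := by
  rw [Fintype.linearIndependent_iff]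
  by_contra! hdep
  obtain ⟨t, ht, l, hl⟩ := hdep
  -- reorder the fields so that the last one depends on the other two
  let σ : Equiv.Perm (Fin 3) := Equiv.swap l 2
  have hσ : σ 2 = l := Equiv.swap_apply_right l 2
  have hrange : (Set.range fun j => Y (σ j) p) = Set.range fun j => Y j p :=
    σ.surjective.range_comp fun j => Y j p
  have hrel : t (σ 0) • Y (σ 0) p + t (σ 1) • Y (σ 1) p + t l • Y l p = 0 := by
    rw [← Equiv.sum_comp σ, Fin.sum_univ_three, hσ] at ht
    exact ht
  -- The four values span `ℂ³` over `ℂ` by genericity, and `Y l p` is redundant since `t l ≠ 0`.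
  have htop : ⊤ ≤ Submodule.span ℂ (Set.range ![Y (σ 0) p, Y (σ 1) p, Z p]) := by
    have hmem : ∀ j, ![Y (σ 0) p, Y (σ 1) p, Z p] j ∈
        Submodule.span ℂ (Set.range ![Y (σ 0) p, Y (σ 1) p, Z p]) :=
      fun j => Submodule.subset_span ⟨j, rfl⟩
    rw [← hM.isGeneric p hp, Submodule.span_le]
    have hle : Submodule.span ℝ (insert (Z p) (Set.range fun j => Y j p)) ≤
        (Submodule.span ℂ (Set.range ![Y (σ 0) p, Y (σ 1) p, Z p])).restrictScalars ℝ := by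
      rw [Submodule.span_le, ← hrange]
      refine Set.insert_subset (hmem 2) (Set.range_subset_iff.2 ?_)
      simp only [Fin.forall_fin_succ]
      refine ⟨hmem 0, hmem 1, ?_, fun i => i.elim0⟩
      change Y (σ 2) p ∈ Submodule.span ℂ _
      have e : Y l p = (-(t l)⁻¹ * t (σ 0)) • Y (σ 0) p + (-(t l)⁻¹ * t (σ 1)) • Y (σ 1) p := by
        have := congrArg (fun v => (t l)⁻¹ • v) hrel
        simp only [smul_add, smul_zero, smul_smul, inv_mul_cancel₀ hl, one_smul] at this
        rw [neg_mul, neg_mul, neg_smul, neg_smul]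
        linear_combination (exp := 1) this
      rw [hσ, e]
      exact add_mem (Submodule.smul_mem _ _ (hmem 0)) (Submodule.smul_mem _ _ (hmem 1))
    exact hspan.trans hle
  have hΔ := linearIndependent_iff_det3_ne_zero.1
    (linearIndependent_of_top_le_span_of_card_eq_finrank htop (by simp))
  obtain ⟨c, hc⟩ := hc
  have hD := det3_ne_zero_of_frame (Y := fun j => Y (σ j)) hM hp hnd (fun j => hY _) hZ
    (fun j => hYM _) hZM (by rwa [hrange])
    ⟨fun i j m => c (σ i) (σ j) (σ m), fun i j => (hc _ _).trans (Eventually.of_forall fun x =>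
      (Equiv.sum_comp σ fun m => c (σ i) (σ j) m • Y m x).symm)⟩ hΔ
  have hli := linearIndependent_iff_det3_ne_zero.2 hD
  have := Fintype.linearIndependent_iff.1 hli ![t (σ 0), t (σ 1), t l]
    (by simpa [Fin.sum_univ_three, hσ] using hrel) 2
  exact hl this

end Core
end CRGeom

/-! ### From germs to representing vector fields. -/

theorem proposition2p1 (M : Set CRGeom.C3) (hM : CRGeom.IsGenericCRSubmanifold M)
    (p : CRGeom.C3) (hp : p ∈ M) (hnd : CRGeom.IsTotallyNondegenerateAt M p)
    (g : LieSubalgebra ℝ (CRGeom.HolVF p)) (hg : CRGeom.ProvidesHomogeneity M p g)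
    (X : Module.Basis (Fin 4) ℝ g) (a : LieSubalgebra ℝ g)
    (ha : a.toSubmodule = Submodule.span ℝ {X 0, X 1, X 2}) :
    LinearIndependent ℂ
      ![CRGeom.eval p (X 0), CRGeom.eval p (X 1), CRGeom.eval p (X 2)] := by
  have hrep : ∀ j, ∃ f : CRGeom.C3 → CRGeom.C3, AnalyticAt ℂ f p ∧
      (f : Germ (𝓝 p) CRGeom.C3) = ((X j : CRGeom.HolVF p) : Germ (𝓝 p) CRGeom.C3) :=
    fun j => (X j : CRGeom.HolVF p).2
  choose f hf hfX using hrep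
  have heval : ∀ j, CRGeom.eval p (X j) = f j p := fun j => by
    change Germ.value ((X j : CRGeom.HolVF p) : Germ (𝓝 p) CRGeom.C3) = _
    rw [← hfX]
    rfl
  have hfM : ∀ j, ∀ᶠ x in 𝓝 p, x ∈ M → f j x ∈ CRGeom.tangentSpace M x := fun j => by
    have : CRGeom.IsTangentGerm M ((X j : CRGeom.HolVF p) : Germ (𝓝 p) CRGeom.C3) :=
      hg.le_infAut (X j).2
    rwa [← hfX, CRGeom.isTangentGerm_coe] at this
  -- The basis fields `0, 1, 2` play the role of the `Y j`, and field `3` that of `Z`.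
  let ι : Fin 3 → Fin 4 := Fin.castSucc
  have hspan : CRGeom.tangentSpace M p ≤
      Submodule.span ℝ (insert (f 3 p) (Set.range fun j => f (ι j) p)) := by
    rw [← hg.map_eval]
    rintro _ ⟨φ, hφ, rfl⟩
    have h : (⟨φ, hφ⟩ : g) = ∑ j, X.repr ⟨φ, hφ⟩ j • X j := (X.sum_repr _).symm
    let L : g →ₗ[ℝ] CRGeom.C3 := CRGeom.eval p ∘ₗ g.toSubmodule.subtype
    have e : CRGeom.eval p φ = ∑ j, X.repr ⟨φ, hφ⟩ j • f j p := by
      have h' := congrArg L h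
      rw [map_sum] at h'
      refine h'.trans (Finset.sum_congr rfl fun j _ => ?_)
      rw [map_smul, ← heval]
      rfl
    rw [e]
    refine Submodule.sum_mem _ fun j _ => Submodule.smul_mem _ _ (Submodule.subset_span ?_)
    refine Fin.lastCases (Or.inl rfl) (fun i => Or.inr ⟨i, rfl⟩) j
  have hbr : ∀ i j : Fin 3, ∃ c : Fin 3 → ℝ,
      VectorField.lieBracket ℝ (f (ι i)) (f (ι j)) =ᶠ[𝓝 p] fun x => ∑ m, c m • f (ι m) x := by
    have hmem : ∀ i : Fin 3, X (ι i) ∈ a := by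
      intro i
      rw [← LieSubalgebra.mem_toSubmodule, ha]
      refine Submodule.subset_span ?_
      fin_cases i
      · exact Or.inl rfl
      · exact Or.inr (Or.inl rfl)
      · exact Or.inr (Or.inr rfl)
    intro i j
    have h := a.lie_mem (hmem i) (hmem j)
    rw [← LieSubalgebra.mem_toSubmodule, ha, Submodule.mem_span_triple] at h
    obtain ⟨c0, c1, c2, h⟩ := h
    refine ⟨![c0, c1, c2], Germ.coe_eq.1 ?_⟩
    have h' := congrArg (fun y : g => ((y : CRGeom.HolVF p) : Germ (𝓝 p) CRGeom.C3)) h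
    have e1 : ((⁅X (ι i), X (ι j)⁆ : g) : CRGeom.HolVF p).1 =
        ((VectorField.lieBracket ℝ (f (ι i)) (f (ι j)) : CRGeom.C3 → CRGeom.C3) :
          Germ (𝓝 p) CRGeom.C3) := by
      rw [← CRGeom.germBracket_coe, hfX, hfX]
      rfl
    rw [← e1]
    refine h'.symm.trans ?_
    change c0 • ((X 0 : CRGeom.HolVF p) : Germ (𝓝 p) CRGeom.C3) +
      c1 • ((X 1 : CRGeom.HolVF p) : Germ (𝓝 p) CRGeom.C3) +
      c2 • ((X 2 : CRGeom.HolVF p) : Germ (𝓝 p) CRGeom.C3) = _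
    rw [← hfX, ← hfX, ← hfX]
    refine Germ.coe_eq.2 (Eventually.of_forall fun x => ?_)
    simp [Fin.sum_univ_three, ι]
  choose c hc using hbr
  have h := CRGeom.linearIndependent_of_frame hM hp hnd (Y := fun j => f (ι j)) (fun j => hf _)
    ((hf 3).eventually_analyticAt.mono fun x hx => CRGeom.contDiffAt_of_analyticAt hx)
    (fun j => hfM _) (hfM 3) hspan ⟨c, hc⟩
  rw [heval, heval, heval]
  convert h using 1
  funext j
  fin_cases j <;> rfl
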